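/- A hexagonal chain with $n$ hexagons is a sequence of $n$ distinct cells of the hexagonal lattice in which two cells share an edge exactly if they are consecutive. A lucasene with $n$ hexagons is a hexagonal chain in which, when numbered from a suitable end, three consecutive hexagons are linearly attached exactly if they are the first three ones (for $n\le 2$: any hexagonal chain with $n$ hexagons). Colour the vertices of the lattice properly black and white; the directed inner dual graph of the chain has the hexagons as vertices and, for every pair of adjacent hexagons, an arc crossing their common edge with the black end of that edge on its left. An L-fence $\Xi_n$ is a poset whose Hasse diagram (arcs pointing from an element to the elements it covers) is isomorphic to the directed inner dual graph of a lucasene with $n$ hexagons; so, up to isomorphism and duality, $\Xi_n$ is the poset $x_1>x_2>x_3<x_4>x_5<\cdots$ on $n$ elements. The matchable Lucas cube $\Omega_n$ ($n\ge 0$) is the undirected Hasse diagram of the lattice of all filters (up-sets) of $\Xi_n$ ordered by reverse inclusion; $\Omega_0$ is a single vertex. Let $h_{n,k}$ be the number of maximal induced $k$-dimensional cubes of $\Omega_n$, i.e. of vertex sets that induce a $k$-dimensional hypercube and are not properly contained in a vertex set inducing a hypercube (of any dimension), with $h_{n,-1}=0$, and let $H_n(x)=\sum_{k\ge 0}h_{n,k}x^k$.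 Let $p'_0=1$, $p'_1=2$, $p'_2=3$ and $p'_n=p'_{n-2}+p'_{n-3}$ for $n\ge 3$ (the $(1,2,3)$-Padovan numbers). Theorem. For all $n\ge 5$ and $k\ge 0$, \[ h_{n,k}=h_{n-2,k-1}+h_{n-3,k-1}. \] Moreover, as formal power series in $y$ over $\mathbb Z[x]$ and over $\mathbb Z$ respectively, \[ \sum_{n\ge 0}H_n(x)\,y^n=\frac{2+y}{1-xy^2(1+y)}-(1-x)y-1, \qquad \sum_{n\ge 0}p'_n\,y^n=\frac{1+2y+2y^2}{1-y^2-y^3}. \] -/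

import Mathlib

/-! ### Hexagonal chains and lucasenes

The cells of the hexagonal lattice are indexed by axial coordinates in `ℤ × ℤ`. -/

/-- The six vectors leading from a cell to its neighbours, in counterclockwise order. -/
def hexDir : Fin 6 → ℤ × ℤ :=
  ![(1, 0), (0, 1), (-1, 1), (-1, 0), (0, -1), (1, -1)]

/-- Two hexagons share an edge. -/
def HexAdj (c d : ℤ × ℤ) : Prop := ∃ i : Fin 6, d = c + hexDir i

/-- The arc of the directed inner dual graph from the hexagon `c` to the hexagon `d`.  The vertices
of the hexagonal lattice are properly coloured black and white; the arc that crosses the common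
edge of two adjacent hexagons is directed so that the black end of this edge lies on its left.
The colours alternate along the boundary of a hexagon, hence the arcs across the six edges of a
hexagon leave and enter it alternately. -/
def HexArc (c d : ℤ × ℤ) : Prop := ∃ i : Fin 6, Even (i : ℕ) ∧ d = c + hexDir i

/-- A hexagonal chain with `n` hexagons: the hexagons `c 0, …, c (n - 1)` are distinct, and two of
them share an edge exactly if they are consecutive. -/
structure IsHexChain {n : ℕ} (c : Fin n → ℤ × ℤ) : Prop where
  injective : Function.Injective c
  adj_iff : ∀ i j : Fin n,
    HexAdj (c i) (c j) ↔ (i : ℕ) + 1 = (j : ℕ) ∨ (j : ℕ) + 1 = (i : ℕ)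

/-- A lucasene with `n` hexagons: a hexagonal chain, numbered from a suitable end, in which three
consecutive hexagons are linearly attached exactly if they are the first three ones.
For `n ≤ 2` this is just a hexagonal chain with `n` hexagons. -/
structure IsLucasene {n : ℕ} (c : Fin n → ℤ × ℤ) : Prop extends IsHexChain c where
  linear_iff : ∀ i j k : Fin n, (j : ℕ) = i + 1 → (k : ℕ) = i + 2 →
    (c k - c j = c j - c i ↔ (i : ℕ) = 0)

/-! ### L-fences and matchable Lucas cubes -/

/-- `P` is an L-fence `Ξ_n`: its Hasse diagram (arcs lead from an element to the elements that it
covers) is isomorphic to the directed inner dual graph of a lucasene with `n` hexagons. -/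
def IsLFence (n : ℕ) (P : Type*) [PartialOrder P] : Prop :=
  ∃ (c : Fin n → ℤ × ℤ) (e : P ≃ Fin n), IsLucasene c ∧
    ∀ a b : P, b ⋖ a ↔ HexArc (c (e a)) (c (e b))

/-- The undirected Hasse diagram of the filter lattice of `P`; for an L-fence `P = Ξ_n` this is the
matchable Lucas cube `Ω_n`.  `UpperSet P` consists of all filters of `P`, ordered by
reverse inclusion. -/
def filterCube (P : Type*) [PartialOrder P] : SimpleGraph (UpperSet P) :=
  SimpleGraph.hasse (UpperSet P)

/-! ### Maximal cube polynomials -/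

/-- The `k`-dimensional cube. -/
def cubeGraph (k : ℕ) : SimpleGraph (Fin k → Bool) where
  Adj u v := hammingDist u v = 1
  symm := ⟨fun u v h => by rwa [hammingDist_comm]⟩
  loopless := ⟨fun u h => by simp at h⟩

/-- The vertex set `S` induces a `k`-dimensional cube in `G`. -/
def InducesCube {V : Type*} (G : SimpleGraph V) (k : ℕ) (S : Set V) : Prop :=
  Nonempty (G.induce S ≃g cubeGraph k)

/-- The vertex set `S` induces a `k`-dimensional cube in `G` that is not properly contained in
another induced cube of `G`. -/
def InducesMaximalCube {V : Type*} (G : SimpleGraph V) (k : ℕ) (S : Set V) : Prop :=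
  InducesCube G k S ∧ ∀ (m : ℕ) (T : Set V), InducesCube G m T → S ⊆ T → T = S

/-- The number `h_k(G)` of maximal induced `k`-dimensional cubes in the finite graph `G`. -/
noncomputable def numMaximalCubes {V : Type*} (G : SimpleGraph V) (k : ℕ) : ℕ :=
  {S : Set V | InducesMaximalCube G k S}.ncard

/-- The maximal cube polynomial `∑_{k ≥ 0} h_k(G) x ^ k` of the finite graph `G`. -/
noncomputable def maximalCubePoly {V : Type*} (G : SimpleGraph V) : Polynomial ℤ :=
  ∑ᶠ k : ℕ, Polynomial.C (numMaximalCubes G k : ℤ) * Polynomial.X ^ k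

/-- The `(1,2,3)`-Padovan numbers. -/
def padovan123 : ℕ → ℕ
  | 0 => 1
  | 1 => 2
  | 2 => 3
  | n + 3 => padovan123 (n + 1) + padovan123 n

/-! ### L-fences exist for every `n` -/

/-- The rank of the `i`-th element (counted from `0`) of the poset
`x₀ > x₁ > x₂ < x₃ > x₄ < ⋯`. -/
def fenceHeight (i : ℕ) : ℕ := if i = 0 then 2 else i % 2

/-- The poset `x₀ > x₁ > x₂ < x₃ > x₄ < ⋯` with `n` elements. -/
structure StdFence (n : ℕ) where
  idx : Fin n

/-- The order of the poset `x₀ > x₁ > x₂ < x₃ > x₄ < ⋯`. -/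
instance (n : ℕ) : PartialOrder (StdFence n) where
  le a b := (a.idx : ℕ) = b.idx ∨ (fenceHeight a.idx < fenceHeight b.idx ∧
    ((a.idx : ℕ) + 1 = b.idx ∨ (b.idx : ℕ) + 1 = a.idx ∨ ((a.idx : ℕ) = 2 ∧ (b.idx : ℕ) = 0)))
  le_refl a := Or.inl rfl
  le_trans a b c := by
    simp only [fenceHeight]
    split_ifs <;> omega
  le_antisymm a b h1 h2 := by
    obtain ⟨⟨a, ha⟩⟩ := a
    obtain ⟨⟨b, hb⟩⟩ := b
    simp only [StdFence.mk.injEq, Fin.mk.injEq] at *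
    omega

theorem StdFence.lt_iff {n : ℕ} (a b : StdFence n) :
    a < b ↔ (fenceHeight a.idx < fenceHeight b.idx ∧
    ((a.idx : ℕ) + 1 = b.idx ∨ (b.idx : ℕ) + 1 = a.idx ∨
      ((a.idx : ℕ) = 2 ∧ (b.idx : ℕ) = 0))) := by
  rw [lt_iff_le_not_ge]
  change ((a.idx : ℕ) = b.idx ∨ (_ ∧ _)) ∧ ¬ ((b.idx : ℕ) = a.idx ∨ (_ ∧ _)) ↔ _
  constructor
  · rintro ⟨h | h, h'⟩
    · omega
    · exact h
  · intro h
    refine ⟨Or.inr h, ?_⟩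
    rintro (h' | h')
    · rw [h'] at h
      omega
    · omega

theorem StdFence.covBy_iff {n : ℕ} (a b : StdFence n) :
    a ⋖ b ↔ (fenceHeight a.idx < fenceHeight b.idx ∧
      ((a.idx : ℕ) + 1 = b.idx ∨ (b.idx : ℕ) + 1 = a.idx)) := by
  constructor
  · rintro ⟨h, h'⟩
    rw [StdFence.lt_iff] at h
    refine ⟨h.1, ?_⟩
    rcases h.2 with h2 | h2 | ⟨h2, h3⟩
    · exact Or.inl h2
    · exact Or.inr h2
    · exfalso
      have hn : 1 < n := by have := a.idx.2; omega
      refine @h' ⟨⟨1, hn⟩⟩ ?_ ?_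
      · rw [StdFence.lt_iff]; simp [h2, fenceHeight]
      · rw [StdFence.lt_iff]; simp [h3, fenceHeight]
  · rintro ⟨h, h'⟩
    refine ⟨(StdFence.lt_iff a b).2 ⟨h, by omega⟩, ?_⟩
    intro c h1 h2
    rw [StdFence.lt_iff] at h1 h2
    simp only [fenceHeight] at *
    split_ifs at * <;> omega

/-- A zigzag lucasene. -/
def stdLucasene (n : ℕ) (i : Fin n) : ℤ × ℤ :=
  if (i : ℕ) = 0 then (-1, 0) else (((i : ℕ) / 2 : ℕ), (((i : ℕ) - 1) / 2 : ℕ))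

theorem hexAdj_iff (c d : ℤ × ℤ) : HexAdj c d ↔
    (d.1 = c.1 + 1 ∧ d.2 = c.2) ∨ (d.1 = c.1 ∧ d.2 = c.2 + 1) ∨
    (d.1 = c.1 - 1 ∧ d.2 = c.2 + 1) ∨ (d.1 = c.1 - 1 ∧ d.2 = c.2) ∨
    (d.1 = c.1 ∧ d.2 = c.2 - 1) ∨ (d.1 = c.1 + 1 ∧ d.2 = c.2 - 1) := by
  simp [HexAdj, hexDir, Fin.exists_fin_succ, Prod.ext_iff, sub_eq_add_neg]

theorem hexArc_iff (c d : ℤ × ℤ) : HexArc c d ↔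
    (d.1 = c.1 + 1 ∧ d.2 = c.2) ∨ (d.1 = c.1 - 1 ∧ d.2 = c.2 + 1) ∨
    (d.1 = c.1 ∧ d.2 = c.2 - 1) := by
  have e1 : ¬ Even 1 := by decide
  have e3 : ¬ Even 3 := by decide
  have e5 : ¬ Even 5 := by decide
  have e2 : Even 2 := by decide
  have e4 : Even 4 := by decide
  simp [HexArc, hexDir, Fin.exists_fin_succ, Prod.ext_iff, sub_eq_add_neg, e1, e2, e3, e4, e5]

theorem isLucasene_stdLucasene (n : ℕ) : IsLucasene (stdLucasene n) where
  injective i j h := by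
    simp only [stdLucasene] at h
    ext
    split_ifs at h <;> simp only [Prod.mk.injEq] at h <;> omega
  adj_iff i j := by
    rw [hexAdj_iff]
    simp only [stdLucasene]
    split_ifs <;> simp only [] <;> omega
  linear_iff i j k hj hk := by
    simp only [stdLucasene, Prod.ext_iff, Prod.fst_sub, Prod.snd_sub]
    split_ifs <;> simp only [] <;> omega

/-- There is an L-fence for every number of hexagons. -/
theorem isLFence_stdFence (n : ℕ) : IsLFence n (StdFence n) := by
  refine ⟨stdLucasene n, ⟨StdFence.idx, StdFence.mk, fun _ => rfl, fun _ => rfl⟩,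
    isLucasene_stdLucasene n, fun a b => ?_⟩
  rw [StdFence.covBy_iff, hexArc_iff]
  simp only [stdLucasene, fenceHeight, Equiv.coe_fn_mk]
  split_ifs <;> simp only [] <;> omega

/-! Two filters are adjacent in the Hasse diagram exactly if they differ in one element
(`filterCube_adj_iff`). Opposite edges of a square flip the same element, so an induced `k`-cube
arises by fixing the membership of all but `k` elements and letting these `k` vary freely
(`exists_directions`). Label the elements `1` (always in), `-1` (never in) or `0` (free). The
choices are independent exactly if every `a < b` has label `-1` at `a` or `1` at `b`. The cube is
maximal exactly if no single label can be changed to `0`: each `1` needs a smaller element not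
labeled `-1`, each `-1` a larger one not labeled `1`. So `h_{n,k}` counts maximal labelings with `k`
zeros (`numMaximalCubes_eq_ncard`).

This count is invariant under isomorphism and, by negating labels, under duality. The arcs along a
chain keep their direction at linearly attached hexagons and reverse it at the others, so every
L-fence is the standard fence or its dual.

The recurrence is read off at the end of the fence (`isMaximalFenceLabeling_add_three_iff`). Suppose
the last element is minimal. Its label is `0` or `-1`. If it is `0`, its neighbour must be `1`, and
removing both leaves an arbitrary maximal labeling of `n - 2` elements. If it is `-1`, its neighbour
must be `0`, which forces `-1` one step further in; removing these three leaves an arbitrary maximal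
labeling of `n - 3` elements. Either way exactly one zero is removed. For `n ≥ 5` the last two
elements are comparable only to their neighbours in the fence. The cases `n ≤ 4` are enumerated, and
the generating functions follow from the recurrence. -/

/-! ### Induced cubes in the Hasse diagram of the filter lattice -/

/-- Two filters are adjacent in the Hasse diagram exactly if they differ in a single element. -/
theorem filterCube_adj_iff {P : Type*} [PartialOrder P] [Finite P] (F G : UpperSet P) :
    (filterCube P).Adj F G ↔ ∃ p, ∀ q, (q ∈ F ↔ q ∈ G) ↔ q ≠ p := by
  -- The order is reverse inclusion, so `G ⊆ F`. Adding to `G` a maximal element `p` of the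
  -- difference gives a filter between the two, which must be `F`.
  have key : ∀ F G : UpperSet P, F ⋖ G → ∃ p, ∀ q, (q ∈ F ↔ q ∈ G) ↔ q ≠ p := by
    intro F G h
    have hsub : ∀ q, q ∈ G → q ∈ F := fun q hq => h.le hq
    have hne : {q | q ∈ F ∧ q ∉ G}.Nonempty := by
      by_contra hemp
      rw [Set.not_nonempty_iff_eq_empty] at hemp
      refine h.lt.not_ge fun q hq => ?_
      by_contra hq'
      exact (hemp ▸ (⟨hq, hq'⟩ : q ∈ {q | q ∈ F ∧ q ∉ G}) : q ∈ (∅ : Set P))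
    obtain ⟨p, hp⟩ := (Set.toFinite {q | q ∈ F ∧ q ∉ G}).exists_maximal hne
    have hup : IsUpperSet (insert p (G : Set P)) := by
      intro a b hab ha
      rcases ha with rfl | ha
      · by_cases hb : b ∈ G
        · exact Or.inr hb
        · exact Or.inl (le_antisymm (hp.2 ⟨F.upper hab hp.1.1, hb⟩ hab) hab)
      · exact Or.inr (G.upper hab ha)
    let K : UpperSet P := ⟨insert p (G : Set P), hup⟩
    have hKF : F ≤ K := by
      intro q hq
      rcases hq with rfl | hq
      · exact hp.1.1
      · exact hsub q hq
    have hKG : K < G := by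
      refine lt_of_le_not_ge (fun q hq => Or.inr hq) fun hle => hp.1.2 (hle (Or.inl rfl))
    have hFK : F = K := by
      by_contra hne'
      exact h.2 (lt_of_le_of_ne hKF hne') hKG
    have hmem : ∀ q, q ∈ F ↔ q = p ∨ q ∈ G := fun q => by rw [hFK]; exact Iff.rfl
    refine ⟨p, fun q => ?_⟩
    rw [hmem]
    have := hp.1.2
    constructor
    · rintro h1 rfl
      exact this (h1.1 (Or.inl rfl))
    · intro h1
      simp [h1]
  have key' : ∀ (F G : UpperSet P) (p : P), (∀ q, (q ∈ F ↔ q ∈ G) ↔ q ≠ p) → p ∈ F → F ⋖ G := by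
    intro F G p h hp
    have hpG : p ∉ G := fun hG => (h p).1 ⟨fun _ => hG, fun _ => hp⟩ rfl
    have hmem : ∀ q, q ≠ p → (q ∈ F ↔ q ∈ G) := fun q hq => (h q).2 hq
    refine ⟨lt_of_le_not_ge (fun q hq => ?_) fun hle => hpG (hle hp), ?_⟩
    · have hqp : q ≠ p := fun e => hpG (e ▸ hq)
      exact (hmem q hqp).2 hq
    · intro K h1 h2
      by_cases hpK : p ∈ K
      · refine h1.not_ge fun q hq => ?_
        by_cases e : q = p
        · exact e ▸ hpK
        · exact h2.le ((hmem q e).1 hq)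
      · refine h2.not_ge fun q hq => ?_
        have e : q ≠ p := fun e => hpK (e ▸ hq)
        exact (hmem q e).1 (h1.le hq)
  constructor
  · rintro (h | h)
    · exact key F G h
    · obtain ⟨p, hp⟩ := key G F h
      exact ⟨p, fun q => by rw [← hp q]; exact iff_comm⟩
  · rintro ⟨p, hp⟩
    by_cases hF : p ∈ F
    · exact Or.inl (key' F G p hp hF)
    · have hG : p ∈ G := by
        by_contra hG
        exact (hp p).1 ⟨fun h => absurd h hF, fun h => absurd h hG⟩ rfl
      exact Or.inr (key' G F p (fun q => by rw [← hp q]; exact iff_comm) hG)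

theorem cubeGraph_adj_iff {k : ℕ} (u v : Fin k → Bool) :
    (cubeGraph k).Adj u v ↔ ∃ i, ∀ j, u j = v j ↔ j ≠ i := by
  change hammingDist u v = 1 ↔ _
  rw [hammingDist, Finset.card_eq_one]
  refine exists_congr fun i => ?_
  rw [Finset.ext_iff]
  refine forall_congr' fun j => ?_
  simp only [Finset.mem_filter, Finset.mem_univ, true_and, Finset.mem_singleton]
  tauto

/-- A labeling of a poset by `-1`, `0`, `1` describes an interval of filters: the elements labeled
`1` belong to all filters of the interval, those labeled `-1` to none.  It is a cube labeling if
the elements labeled `0` can be chosen freely. -/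
def IsCubeLabeling {P : Type*} [PartialOrder P] (f : P → SignType) : Prop :=
  ∀ a b, a < b → f a = -1 ∨ f b = 1

/-- A cube labeling in which no label can be changed to `0`. -/
structure IsMaximalCubeLabeling {P : Type*} [PartialOrder P] (f : P → SignType) : Prop where
  isCubeLabeling : IsCubeLabeling f
  exists_lt : ∀ p, f p = 1 → ∃ a, a < p ∧ f a ≠ -1
  exists_gt : ∀ p, f p = -1 → ∃ b, p < b ∧ f b ≠ 1

/-- The interval of filters described by a labeling. -/
def cubeSet {P : Type*} [PartialOrder P] (f : P → SignType) : Set (UpperSet P) :=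
  {F | ∀ p, (f p = 1 → p ∈ F) ∧ (p ∈ F → f p ≠ -1)}

/-- An injective map from the vertices of a cube to filters that preserves adjacency moves along
every edge of the same direction by the same element. -/
theorem exists_directions {P : Type*} {k : ℕ} (g : Finset (Fin k) → Set P)
    (hinj : Function.Injective g)
    (hadj : ∀ i s, i ∉ s → ∃ p, ∀ q, (q ∈ g (insert i s) ↔ q ∈ g s) ↔ q ≠ p) :
    ∃ z : Fin k → P, Function.Injective z ∧
      ∀ s q, (q ∈ g s ↔ q ∈ g ∅) ↔ ¬ ∃ i ∈ s, z i = q := by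
  have h0 : ∀ i, ∃ p, ∀ q, (q ∈ g {i} ↔ q ∈ g ∅) ↔ q ≠ p := fun i => by
    simpa using hadj i ∅ (by simp)
  choose z hz using h0
  have hzinj : Function.Injective z := by
    intro i j hij
    have : g {i} = g {j} := by
      ext q
      have h1 := hz i q
      have h2 := hz j q
      rw [hij] at h1
      tauto
    simpa using hinj this
  refine ⟨z, hzinj, fun s => ?_⟩
  have step : ∀ s : Finset (Fin k), ∀ i ∉ s, ∀ q, (q ∈ g (insert i s) ↔ q ∈ g s) ↔ q ≠ z i := by
    intro s
    induction s using Finset.induction_on with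
    | empty => intro i _ q; simpa using hz i q
    | insert j t hj ih =>
      intro i hi
      have hij : i ≠ j := fun e => hi (by simp [e])
      have hit : i ∉ t := fun e => hi (by simp [e])
      have h1 := ih i hit
      have h2 := ih j hj
      obtain ⟨a, ha⟩ := hadj i _ hi
      obtain ⟨b, hb⟩ := hadj j (insert i t) (by simp [hij.symm, hj])
      rw [Finset.insert_comm] at hb
      have hzz : z i ≠ z j := fun e => hij (hzinj e)
      -- In the square on `t`, `t + i`, `t + j`, `t + i + j` both paths from `t` to the opposite
      -- corner flip the same set, so `{z j, a} = {z i, b}`. Since `z i ≠ z j`, this forces `a = z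
      -- i`. The degenerate possibility `a = z j` would identify opposite corners.
      have haj : a ≠ z j := by
        rintro rfl
        have : g (insert i (insert j t)) = g t := by
          ext q
          have := ha q
          have := h2 q
          tauto
        have h3 := hinj this
        exact hit (h3 ▸ Finset.mem_insert_self _ _)
      have hai : a = z i := by
        by_contra hne
        have hbi : z i = b := by
          by_contra hb'
          have := (ha (z i)).2 (Ne.symm hne)
          have := (h2 (z i)).2 hzz
          have := (hb (z i)).2 hb'
          exact (h1 (z i)).1 (by grind) rfl
        have hbj : z j = b := by
          by_contra hb'
          have := (ha (z j)).2 haj.symm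
          have := (h1 (z j)).2 hzz.symm
          have := (hb (z j)).2 hb'
          exact (h2 (z j)).1 (by grind) rfl
        exact hzz (hbi.trans hbj.symm)
      exact hai ▸ ha
  induction s using Finset.induction_on with
  | empty => simp
  | insert i t hi ih =>
    intro q
    have h1 := step t i hi q
    have h2 := ih q
    by_cases e : q = z i
    · have h3 : ¬ ∃ j ∈ t, z j = q := by
        rintro ⟨j, hj, e'⟩
        exact hi (hzinj (e'.trans e) ▸ hj)
      have h4 : ∃ j ∈ insert i t, z j = q := ⟨i, by simp, e.symm⟩
      exact ⟨fun h => absurd e (h1.1 (h.trans (h2.2 h3).symm)), fun h => absurd h4 h⟩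
    · have h4 : (∃ j ∈ insert i t, z j = q) ↔ ∃ j ∈ t, z j = q := by
        simp [Ne.symm e]
      rw [h4, h1.2 e, h2]

/-! ### Correspondence between cube labelings and induced cubes -/

section Labelings

variable {P : Type*} [PartialOrder P]

theorem SignType.eq_cases (s : SignType) : s = -1 ∨ s = 0 ∨ s = 1 := by
  cases s <;> decide

theorem IsCubeLabeling.isUpperSet_of_between {f : P → SignType} (hf : IsCubeLabeling f)
    {S : Set P} (h1 : ∀ p, f p = 1 → p ∈ S) (h2 : ∀ p ∈ S, f p ≠ -1) : IsUpperSet S := by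
  intro a b hab ha
  rcases hab.eq_or_lt with rfl | hlt
  · exact ha
  · rcases hf a b hlt with h | h
    · exact absurd h (h2 a ha)
    · exact h1 b h

theorem IsCubeLabeling.inducesCube [Finite P] {f : P → SignType} (hf : IsCubeLabeling f) :
    InducesCube (filterCube P) {p | f p = 0}.ncard (cubeSet f) := by
  classical
  let e : {p | f p = 0} ≃ Fin {p | f p = 0}.ncard :=
    Finite.equivFinOfCardEq (Nat.card_coe_set_eq _)
  let toFun : cubeSet f → (Fin {p | f p = 0}.ncard → Bool) :=
    fun F i => decide ((e.symm i : P) ∈ F.1)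
  let base : (Fin {p | f p = 0}.ncard → Bool) → Set P :=
    fun v => {p | f p = 1 ∨ ∃ h : f p = 0, v (e ⟨p, h⟩) = true}
  have hb1 : ∀ v p, f p = 1 → p ∈ base v := fun v p h => Or.inl h
  have hb2 : ∀ v, ∀ p ∈ base v, f p ≠ -1 := by
    rintro v p (h | ⟨h, -⟩) <;> rw [h] <;> decide
  let invFun : (Fin {p | f p = 0}.ncard → Bool) → cubeSet f :=
    fun v => ⟨⟨base v, hf.isUpperSet_of_between (hb1 v) (hb2 v)⟩, fun p => ⟨hb1 v p, hb2 v p⟩⟩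
  refine ⟨⟨⟨toFun, invFun, fun F => ?_, fun v => ?_⟩, fun {F G} => ?_⟩⟩
  · ext p
    change (f p = 1 ∨ ∃ h : f p = 0, toFun F (e ⟨p, h⟩) = true) ↔ p ∈ F.1
    simp only [toFun, decide_eq_true_eq, Equiv.symm_apply_apply]
    have h1 := F.2 p
    rcases SignType.eq_cases (f p) with h | h | h <;> simp [h] at h1 ⊢ <;> tauto
  · funext i
    have hi : f (e.symm i) = 0 := (e.symm i).2
    have : ((e.symm i : P) ∈ (invFun v).1) ↔ v i = true := by
      change (f (e.symm i) = 1 ∨ ∃ h : f (e.symm i) = 0, v (e ⟨_, h⟩) = true) ↔ _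
      simp [hi]
    change decide ((e.symm i : P) ∈ (invFun v).1) = v i
    rw [Bool.eq_iff_iff, decide_eq_true_eq, this]
  · change (cubeGraph _).Adj (toFun F) (toFun G) ↔ (filterCube P).Adj F.1 G.1
    rw [cubeGraph_adj_iff, filterCube_adj_iff]
    simp only [toFun, decide_eq_decide]
    have hfix : ∀ q, f q ≠ 0 → (q ∈ F.1 ↔ q ∈ G.1) := by
      intro q hq
      have h1 := F.2 q
      have h2 := G.2 q
      rcases SignType.eq_cases (f q) with h | h | h <;> simp [h] at h1 h2 hq ⊢ <;> tauto
    constructor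
    · rintro ⟨i, hi⟩
      refine ⟨e.symm i, fun q => ?_⟩
      by_cases hq : f q = 0
      · have := hi (e ⟨q, hq⟩)
        rw [Equiv.symm_apply_apply] at this
        rw [this, Ne, Ne, ← Equiv.eq_symm_apply, Subtype.ext_iff]
      · simp only [hfix q hq, true_iff]
        rintro rfl
        exact hq (e.symm i).2
    · rintro ⟨p, hp⟩
      have h0 : f p = 0 := by
        by_contra h
        exact (hp p).1 (hfix p h) rfl
      refine ⟨e ⟨p, h0⟩, fun j => ?_⟩
      rw [hp, Ne, Ne, ← Equiv.symm_apply_eq, Subtype.ext_iff]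

/-- The elements flipped by the `k` edge directions get label `0`. All other elements have constant
membership on the cube, which can be read off at the vertex `g ∅`. -/
theorem exists_cubeLabeling_of_inducesCube [Finite P] {k : ℕ} {S : Set (UpperSet P)}
    (h : InducesCube (filterCube P) k S) :
    ∃ f : P → SignType, IsCubeLabeling f ∧ {p | f p = 0}.ncard = k ∧ S = cubeSet f := by
  classical
  obtain ⟨φ⟩ := h
  let g : Finset (Fin k) → UpperSet P := fun s => (φ.symm fun i => decide (i ∈ s)).1
  have hinj : Function.Injective g := by
    intro s t hst
    have := φ.symm.injective (Subtype.ext hst)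
    ext i
    simpa using congrFun this i
  have hadj : ∀ i s, i ∉ s → ∃ p, ∀ q, (q ∈ g (insert i s) ↔ q ∈ g s) ↔ q ≠ p := by
    intro i s hi
    rw [← filterCube_adj_iff]
    change ((filterCube P).induce S).Adj (φ.symm _) (φ.symm _)
    rw [φ.symm.map_adj_iff, cubeGraph_adj_iff]
    refine ⟨i, fun j => ?_⟩
    rw [decide_eq_decide, Finset.mem_insert]
    constructor
    · rintro h rfl
      exact hi (h.1 (Or.inl rfl))
    · intro h
      simp [h]
  obtain ⟨z, hz, hg⟩ := exists_directions (fun s => (g s : Set P))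
    (fun s t h => hinj (SetLike.coe_injective h)) hadj
  have hg : ∀ s q, (q ∈ g s ↔ q ∈ g ∅) ↔ ¬ ∃ i ∈ s, z i = q := hg
  let f : P → SignType := fun p => if p ∈ Set.range z then 0 else if p ∈ g ∅ then 1 else -1
  have f0 : ∀ p, f p = 0 ↔ p ∈ Set.range z := by
    intro p; simp only [f]; split_ifs <;> simp_all
  have f1 : ∀ p, f p = 1 ↔ p ∉ Set.range z ∧ p ∈ g ∅ := by
    intro p; simp only [f]; split_ifs <;> simp_all
  have f2 : ∀ p, f p = -1 ↔ p ∉ Set.range z ∧ p ∉ g ∅ := by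
    intro p; simp only [f]; split_ifs <;> simp_all
  refine ⟨f, ?_, ?_, ?_⟩
  · intro a b hab
    by_contra hcon
    rw [f2, f1] at hcon
    -- If the condition fails at `a < b`, then `a` is free or always in, and `b` is free or always
    -- out. Flipping them where necessary gives a vertex containing `a` but not `b`, which is not an
    -- up-set.
    let s : Finset (Fin k) :=
      Finset.univ.filter fun i => (z i = a ∧ a ∉ g ∅) ∨ (z i = b ∧ b ∈ g ∅)
    have hs : ∀ q, (∃ i ∈ s, z i = q) ↔
        q ∈ Set.range z ∧ ((q = a ∧ a ∉ g ∅) ∨ (q = b ∧ b ∈ g ∅)) := by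
      intro q
      simp only [s, Finset.mem_filter, Finset.mem_univ, true_and, Set.mem_range]
      constructor
      · rintro ⟨i, h, rfl⟩; exact ⟨⟨i, rfl⟩, h⟩
      · rintro ⟨⟨i, rfl⟩, h⟩; exact ⟨i, h, rfl⟩
    have ha := hg s a
    have hb := hg s b
    rw [hs] at ha hb
    have hne := hab.ne
    have hne' := hab.ne'
    have hup : a ∈ g s → b ∈ g s := fun h => (g s).upper hab.le h
    grind
  · have : {p | f p = 0} = Set.range z := by ext p; exact f0 p
    rw [this, ← Set.image_univ, Set.ncard_image_of_injective _ hz, Set.ncard_univ, Nat.card_fin]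
  · ext F
    constructor
    · intro hF
      obtain ⟨s, rfl⟩ : ∃ s, g s = F := by
        refine ⟨Finset.univ.filter fun i => φ ⟨F, hF⟩ i = true, ?_⟩
        simp [g]
      intro p
      have h1 := hg s p
      have h2 : (∃ i ∈ s, z i = p) → p ∈ Set.range z := by
        rintro ⟨i, -, rfl⟩; exact ⟨i, rfl⟩
      rw [f1, Ne, f2]
      tauto
    · intro hF
      have : F = g (Finset.univ.filter fun i => ¬ (z i ∈ F ↔ z i ∈ g ∅)) := by
        ext q
        have h1 := hg (Finset.univ.filter fun i => ¬ (z i ∈ F ↔ z i ∈ g ∅)) q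
        have h2 := hF q
        rw [f1, Ne, f2] at h2
        have h3 : (∃ i ∈ Finset.univ.filter (fun i => ¬ (z i ∈ F ↔ z i ∈ g ∅)), z i = q) ↔
            q ∈ Set.range z ∧ ¬ (q ∈ F ↔ q ∈ g ∅) := by
          simp only [Finset.mem_filter, Finset.mem_univ, true_and, Set.mem_range]
          constructor
          · rintro ⟨i, h, rfl⟩; exact ⟨⟨i, rfl⟩, h⟩
          · rintro ⟨⟨i, rfl⟩, h⟩; exact ⟨i, h, rfl⟩
        rw [h3] at h1
        tauto
      rw [this]
      exact (φ.symm _).2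

theorem IsCubeLabeling.cubeSet_subset_iff {f g : P → SignType} (hf : IsCubeLabeling f) :
    cubeSet f ⊆ cubeSet g ↔ ∀ p, g p = 0 ∨ g p = f p := by
  constructor
  · intro h p
    -- The smallest and the largest set in the interval of `f`. Their membership in `cubeSet g`
    -- already determines every nonzero label of `g`.
    let B : UpperSet P := ⟨{p | f p = 1}, hf.isUpperSet_of_between (fun _ h => h)
      (fun p (h : f p = 1) => by rw [h]; decide)⟩
    let T : UpperSet P := ⟨{p | f p ≠ -1}, hf.isUpperSet_of_between
      (fun p (h : f p = 1) => by simp [h]) (fun _ h => h)⟩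
    have hB : B ∈ cubeSet f := fun p => ⟨fun h => h, fun (h : f p = 1) => by rw [h]; decide⟩
    have hT : T ∈ cubeSet f := fun p => ⟨fun h => by change f p ≠ -1; rw [h]; decide, fun h => h⟩
    have h1 : (g p = 1 → f p = 1) ∧ (f p = 1 → g p ≠ -1) := h hB p
    have h2 : (g p = 1 → f p ≠ -1) ∧ (f p ≠ -1 → g p ≠ -1) := h hT p
    rcases SignType.eq_cases (g p) with e | e | e
    · have : f p = -1 := by tauto
      exact Or.inr (e.trans this.symm)
    · exact Or.inl e
    · exact Or.inr (e.trans (h1.1 e).symm)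
  · intro h F hF p
    rcases h p with e | e
    · rw [e]; exact ⟨fun h => absurd h (by decide), fun _ => by decide⟩
    · rw [e]; exact hF p

theorem IsCubeLabeling.eq_of_cubeSet_eq {f g : P → SignType} (hf : IsCubeLabeling f)
    (hg : IsCubeLabeling g) (h : cubeSet f = cubeSet g) : f = g := by
  funext p
  have h1 := hf.cubeSet_subset_iff.1 h.subset p
  have h2 := hg.cubeSet_subset_iff.1 h.symm.subset p
  rcases h1 with h1 | h1
  · rcases h2 with h2 | h2
    · rw [h1, h2]
    · exact h2
  · exact h1.symm

theorem inducesMaximalCube_iff [Finite P] (k : ℕ) (S : Set (UpperSet P)) :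
    InducesMaximalCube (filterCube P) k S ↔
      ∃ f : P → SignType, (IsMaximalCubeLabeling f ∧ {p | f p = 0}.ncard = k) ∧ cubeSet f = S := by
  classical
  constructor
  · rintro ⟨h, hmax⟩
    obtain ⟨f, hf, hk, rfl⟩ := exists_cubeLabeling_of_inducesCube h
    refine ⟨f, ⟨⟨hf, ?_, ?_⟩, hk⟩, rfl⟩
    all_goals
      intro p hp
      -- Without a witness, relabeling `p` by `0` keeps the cube condition and gives a strictly
      -- larger cube. The alternatives under `first` serve the labels `1` and `-1` of `p`.
      by_contra! hcon
      have hg : IsCubeLabeling (Function.update f p 0) := by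
        intro a b hab
        have h1 := hf a b hab
        have h2 := hab.ne
        by_cases ha : a = p
        · subst ha
          have h3 : b ≠ a := hab.ne'
          simp only [Function.update_self, Function.update_of_ne h3]
          first
            | exact Or.inr (hcon b hab)
            | (rw [hp] at h1; exact Or.inr (h1.resolve_left (by decide)))
        · by_cases hb : b = p
          · subst hb
            simp only [Function.update_self, Function.update_of_ne ha]
            first
              | exact Or.inl (hcon a hab)
              | (rw [hp] at h1; exact Or.inl (h1.resolve_right (by decide)))
          · simpa only [Function.update_of_ne ha, Function.update_of_ne hb] using h1
      have hsub : cubeSet f ⊆ cubeSet (Function.update f p 0) := by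
        rw [hf.cubeSet_subset_iff]
        intro q
        by_cases hq : q = p
        · subst hq; simp
        · simp [Function.update_of_ne hq]
      have := congrFun (hg.eq_of_cubeSet_eq hf (hmax _ _ hg.inducesCube hsub)) p
      rw [Function.update_self, hp] at this
      exact absurd this (by decide)
  · rintro ⟨f, ⟨hf, rfl⟩, rfl⟩
    refine ⟨hf.isCubeLabeling.inducesCube, fun m T hT hsub => ?_⟩
    obtain ⟨g, hg, -, rfl⟩ := exists_cubeLabeling_of_inducesCube hT
    have h := hf.isCubeLabeling.cubeSet_subset_iff.1 hsub
    congr 1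
    funext p
    refine (h p).elim (fun h0 => ?_) id
    rcases SignType.eq_cases (f p) with e | e | e
    -- The witness `b` blocks any enlargement, even one that frees several elements: if `g p = 0`,
    -- then `g b = 1`, but `g b` is `0` or `f b ≠ 1`.
    · obtain ⟨b, hb, hb'⟩ := hf.exists_gt p e
      rcases hg p b hb with h1 | h1
      · exact h1.trans e.symm
      · rcases h b with h2 | h2
        · exact absurd (h2.symm.trans h1) (by decide)
        · exact absurd (h2.symm.trans h1) hb'
    · rw [h0, e]
    · obtain ⟨a, ha, ha'⟩ := hf.exists_lt p e
      rcases hg a p ha with h1 | h1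
      · rcases h a with h2 | h2
        · exact absurd (h2.symm.trans h1) (by decide)
        · exact absurd (h2.symm.trans h1) ha'
      · exact h1.trans e.symm

/-- Maximal induced cubes of the filter lattice correspond to maximal cube labelings. -/
theorem numMaximalCubes_eq_ncard [Finite P] (k : ℕ) :
    numMaximalCubes (filterCube P) k =
      {f : P → SignType | IsMaximalCubeLabeling f ∧ {p | f p = 0}.ncard = k}.ncard := by
  rw [numMaximalCubes]
  have : {S | InducesMaximalCube (filterCube P) k S} =
      cubeSet '' {f : P → SignType | IsMaximalCubeLabeling f ∧ {p | f p = 0}.ncard = k} := by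
    ext S
    exact inducesMaximalCube_iff k S
  rw [this, Set.InjOn.ncard_image]
  intro f hf g hg h
  exact hf.1.isCubeLabeling.eq_of_cubeSet_eq hg.1.isCubeLabeling h

end Labelings

/-! ### Every L-fence is the standard fence or its dual -/

/-- Complements of filters are the filters of the dual order, so "always in" and "never in" trade
places, and with them the two witness conditions. -/
theorem IsMaximalCubeLabeling.neg_comp_of_dual {P Q : Type*} [PartialOrder P] [PartialOrder Q]
    (e : P ≃o Qᵒᵈ) {f : Q → SignType} (hf : IsMaximalCubeLabeling f) :
    IsMaximalCubeLabeling fun p => -f (OrderDual.ofDual (e p)) := by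
  have hlt : ∀ a b : P, a < b ↔ OrderDual.ofDual (e b) < OrderDual.ofDual (e a) :=
    fun a b => (e.lt_iff_lt (x := a) (y := b)).symm
  refine ⟨fun a b hab => ?_, fun p hp => ?_, fun p hp => ?_⟩
  · rcases hf.isCubeLabeling _ _ ((hlt a b).1 hab) with h | h
    · right; simp [h]
    · left; simp [h]
  · obtain ⟨b, hb, hb'⟩ := hf.exists_gt (OrderDual.ofDual (e p)) (by rw [← hp, neg_neg])
    refine ⟨e.symm (OrderDual.toDual b), (hlt _ _).2 (by simpa using hb), ?_⟩
    simpa using hb'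
  · obtain ⟨b, hb, hb'⟩ := hf.exists_lt (OrderDual.ofDual (e p)) (by simpa using hp)
    refine ⟨e.symm (OrderDual.toDual b), (hlt _ _).2 (by simpa using hb), ?_⟩
    simp only [OrderIso.apply_symm_apply, OrderDual.ofDual_toDual]
    rwa [Ne, neg_eq_iff_eq_neg]

theorem IsMaximalCubeLabeling.comp_orderIso {P Q : Type*} [PartialOrder P] [PartialOrder Q]
    (e : P ≃o Q) {f : Q → SignType} (hf : IsMaximalCubeLabeling f) :
    IsMaximalCubeLabeling (f ∘ e) := by
  refine ⟨fun a b hab => hf.isCubeLabeling _ _ (e.lt_iff_lt.2 hab), fun p hp => ?_, fun p hp => ?_⟩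
  · obtain ⟨b, hb, hb'⟩ := hf.exists_lt (e p) hp
    exact ⟨e.symm b, by rwa [e.symm_apply_lt], by simpa using hb'⟩
  · obtain ⟨b, hb, hb'⟩ := hf.exists_gt (e p) hp
    exact ⟨e.symm b, by rwa [e.lt_symm_apply], by simpa using hb'⟩

theorem numMaximalCubes_filterCube_congr {P Q : Type*} [PartialOrder P] [PartialOrder Q]
    [Finite P] [Finite Q] (h : Nonempty (P ≃o Q) ∨ Nonempty (P ≃o Qᵒᵈ)) (k : ℕ) :
    numMaximalCubes (filterCube P) k = numMaximalCubes (filterCube Q) k := by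
  rw [numMaximalCubes_eq_ncard, numMaximalCubes_eq_ncard]
  rcases h with ⟨⟨e⟩⟩ | ⟨⟨e⟩⟩
  · refine Set.ncard_congr (fun f _ => f ∘ e.symm) ?_ ?_ ?_
    · rintro f ⟨hf, hk⟩
      refine ⟨hf.comp_orderIso e.symm, ?_⟩
      rw [← hk]
      exact Set.ncard_preimage_of_injective_subset_range (s := {p | f p = 0}) e.symm.injective
        (by simp [e.symm.surjective.range_eq])
    · intro f g _ _ h
      exact e.symm.surjective.injective_comp_right h
    · rintro f ⟨hf, hk⟩
      refine ⟨f ∘ e, ⟨hf.comp_orderIso e, ?_⟩, by ext; simp⟩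
      rw [← hk]
      exact Set.ncard_preimage_of_injective_subset_range (s := {p | f p = 0}) e.injective
        (by simp [e.surjective.range_eq])
  · let e' : Q ≃o Pᵒᵈ := (OrderIso.dualDual Q).trans e.symm.dual
    have h1 : ∀ q, OrderDual.ofDual (e (OrderDual.ofDual (e' q))) = q := fun q =>
      e.apply_symm_apply (OrderDual.toDual q)
    have h2 : ∀ p, OrderDual.ofDual (e' (OrderDual.ofDual (e p))) = p := fun p =>
      e.symm_apply_apply p
    refine Set.ncard_congr (fun f _ q => -f (OrderDual.ofDual (e' q))) ?_ ?_ ?_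
    · rintro f ⟨hf, hk⟩
      refine ⟨hf.neg_comp_of_dual e', ?_⟩
      rw [← hk]
      simp only [neg_eq_iff_eq_neg, neg_zero]
      exact Set.ncard_preimage_of_injective_subset_range (s := {p | f p = 0})
        (f := fun q => OrderDual.ofDual (e' q)) e'.injective
        fun p _ => ⟨_, h2 p⟩
    · intro f g _ _ h
      funext p
      have := congrFun h (OrderDual.ofDual (e p))
      simpa [h2] using this
    · rintro f ⟨hf, hk⟩
      refine ⟨_, ⟨hf.neg_comp_of_dual e, ?_⟩, by funext q; simp [h1]⟩
      rw [← hk]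
      simp only [neg_eq_iff_eq_neg, neg_zero]
      exact Set.ncard_preimage_of_injective_subset_range (s := {p | f p = 0})
        (f := fun q => OrderDual.ofDual (e q)) e.injective
        fun p _ => ⟨_, h1 p⟩

/-- In a finite poset the order is the reflexive transitive closure of the covering relation. -/
theorem orderIso_of_covBy_iff {P Q : Type*} [PartialOrder P] [PartialOrder Q] [Finite P] [Finite Q]
    (e : P ≃ Q) (h : ∀ a b, a ⋖ b ↔ e a ⋖ e b) : Nonempty (P ≃o Q) := by
  have : Fintype P := Fintype.ofFinite P
  have : Fintype Q := Fintype.ofFinite Q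
  classical
  have : LocallyFiniteOrder P := Fintype.toLocallyFiniteOrder
  have : LocallyFiniteOrder Q := Fintype.toLocallyFiniteOrder
  refine ⟨⟨e, fun {a b} => ?_⟩⟩
  rw [le_iff_reflTransGen_covBy, le_iff_reflTransGen_covBy]
  constructor
  · intro hab
    have := Relation.ReflTransGen.lift (p := (· ⋖ ·)) e.symm
      (fun a b (hab : a ⋖ b) => (h _ _).2 (by simpa using hab)) _ _ hab
    simpa [Function.onFun] using this
  · exact fun hab => Relation.ReflTransGen.lift (p := (· ⋖ ·)) e (fun a b hab => (h a b).1 hab) _ _ hab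

theorem hexArc_or_hexArc {c d : ℤ × ℤ} (h : HexAdj c d) : HexArc c d ↔ ¬ HexArc d c := by
  rw [hexAdj_iff] at h
  rw [hexArc_iff, hexArc_iff]
  omega

theorem HexArc.hexAdj {c d : ℤ × ℤ} (h : HexArc c d) : HexAdj c d := by
  obtain ⟨i, -, hi⟩ := h
  exact ⟨i, hi⟩

/-- The arcs of a hexagonal chain have the same direction at linearly attached hexagons and
opposite directions at the others. -/
theorem hexArc_iff_of_chain {a b c : ℤ × ℤ} (hab : HexAdj a b) (hbc : HexAdj b c)
    (hac : ¬ HexAdj a c) (hne : a ≠ c) :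
    (HexArc b c ↔ HexArc a b) ↔ c - b = b - a := by
  rw [hexAdj_iff] at hab hbc hac
  rw [hexArc_iff, hexArc_iff]
  rw [Ne, Prod.ext_iff] at hne
  simp only [Prod.ext_iff, Prod.fst_sub, Prod.snd_sub]
  rcases hab with ⟨h1, h2⟩ | ⟨h1, h2⟩ | ⟨h1, h2⟩ | ⟨h1, h2⟩ | ⟨h1, h2⟩ | ⟨h1, h2⟩ <;>
  rcases hbc with ⟨h3, h4⟩ | ⟨h3, h4⟩ | ⟨h3, h4⟩ | ⟨h3, h4⟩ | ⟨h3, h4⟩ | ⟨h3, h4⟩ <;>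
  omega

/-- The first arc determines all others. The heights `2, 1, 0, 1, 0, …` continue in the same
direction only at the first three indices, exactly where the lucasene is linear. -/
theorem IsLucasene.hexArc_succ_iff {n : ℕ} {c : Fin n → ℤ × ℤ} (hc : IsLucasene c) (i : ℕ)
    (hi : i + 1 < n) :
    HexArc (c ⟨i, by omega⟩) (c ⟨i + 1, hi⟩) ↔
      (fenceHeight (i + 1) < fenceHeight i ↔
        HexArc (c ⟨0, by omega⟩) (c ⟨1, by omega⟩)) := by
  induction i with
  | zero => simp [fenceHeight]
  | succ i ih =>
    have ih := ih (by omega)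
    have h := hexArc_iff_of_chain (a := c ⟨i, by omega⟩) (b := c ⟨i + 1, by omega⟩)
      (c := c ⟨i + 2, hi⟩) ((hc.adj_iff _ _).2 (Or.inl rfl)) ((hc.adj_iff _ _).2 (Or.inl rfl))
      (by rw [hc.adj_iff]; simp; omega)
      (fun h => by have := congrArg Fin.val (hc.injective h); simp at this)
    rw [hc.linear_iff _ _ _ rfl rfl] at h
    have h2 : (fenceHeight (i + 1 + 1) < fenceHeight (i + 1) ↔
        fenceHeight (i + 1) < fenceHeight i) ↔ i = 0 := by
      simp only [fenceHeight]
      split_ifs <;> grind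
    simp only [] at h
    tauto

theorem IsLucasene.hexArc_iff_fenceHeight {n : ℕ} {c : Fin n → ℤ × ℤ} (hc : IsLucasene c) :
    (∀ i j : Fin n, HexArc (c i) (c j) ↔ fenceHeight j < fenceHeight i ∧
      ((j : ℕ) + 1 = i ∨ (i : ℕ) + 1 = j)) ∨
    (∀ i j : Fin n, HexArc (c i) (c j) ↔ fenceHeight i < fenceHeight j ∧
      ((i : ℕ) + 1 = j ∨ (j : ℕ) + 1 = i)) := by
  have hlt : ∀ i, fenceHeight (i + 1) < fenceHeight i ↔ ¬ fenceHeight i < fenceHeight (i + 1) := by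
    intro i; simp only [fenceHeight]; split_ifs <;> grind
  have hadj : ∀ i j : Fin n, HexArc (c i) (c j) → (i : ℕ) + 1 = j ∨ (j : ℕ) + 1 = i :=
    fun i j h => (hc.adj_iff i j).1 h.hexAdj
  by_cases hn : 1 < n
  · by_cases h0 : HexArc (c ⟨0, by omega⟩) (c ⟨1, by omega⟩)
    · left
      intro i j
      by_cases h1 : (i : ℕ) + 1 = j
      · have := hc.hexArc_succ_iff i (by omega)
        have ej : j = ⟨i + 1, by omega⟩ := Fin.ext h1.symm
        rw [ej]
        simp only [h0, iff_true] at this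
        simpa using this
      · by_cases h2 : (j : ℕ) + 1 = i
        · have := hc.hexArc_succ_iff j (by omega)
          have ei : i = ⟨j + 1, by omega⟩ := Fin.ext h2.symm
          have h3 := hexArc_or_hexArc ((hc.adj_iff i j).2 (Or.inr h2))
          have h4 := hlt j
          rw [h3]
          rw [ei]
          simp only [h0, iff_true] at this
          simp only [this]
          simp; omega
        · exact ⟨fun h => absurd (hadj i j h) (by omega), fun h => absurd h.2 (by omega)⟩
    · right
      intro i j
      by_cases h1 : (i : ℕ) + 1 = j
      · have := hc.hexArc_succ_iff i (by omega)
        have ej : j = ⟨i + 1, by omega⟩ := Fin.ext h1.symm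
        have h4 := hlt i
        rw [ej]
        simp only [h0, iff_false] at this
        simp only [this]
        simp; omega
      · by_cases h2 : (j : ℕ) + 1 = i
        · have := hc.hexArc_succ_iff j (by omega)
          have ei : i = ⟨j + 1, by omega⟩ := Fin.ext h2.symm
          have h3 := hexArc_or_hexArc ((hc.adj_iff i j).2 (Or.inr h2))
          have h4 := hlt j
          rw [h3]
          rw [ei]
          simp only [h0, iff_false] at this
          simp only [this]
          simp
        · exact ⟨fun h => absurd (hadj i j h) (by omega), fun h => absurd h.2 (by omega)⟩
  · left
    intro i j
    exact ⟨fun h => absurd (hadj i j h) (by omega), fun h => absurd h.2 (by omega)⟩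

instance StdFence.finite (n : ℕ) : Finite (StdFence n) :=
  Finite.of_injective StdFence.idx fun a b h => by cases a; cases b; cases h; rfl

theorem IsLFence.finite {n : ℕ} {P : Type*} [PartialOrder P] (h : IsLFence n P) : Finite P := by
  obtain ⟨-, e, -, -⟩ := h
  exact Finite.of_equiv _ e.symm

theorem IsLFence.orderIso_stdFence {n : ℕ} {P : Type*} [PartialOrder P] (h : IsLFence n P) :
    Nonempty (P ≃o StdFence n) ∨ Nonempty (P ≃o (StdFence n)ᵒᵈ) := by
  have := h.finite
  obtain ⟨c, e, hc, he⟩ := h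
  let e₁ : P ≃ StdFence n := e.trans ⟨StdFence.mk, StdFence.idx, fun _ => rfl, fun _ => rfl⟩
  rcases hc.hexArc_iff_fenceHeight with h | h
  · left
    refine orderIso_of_covBy_iff e₁ fun a b => ?_
    rw [he, h, StdFence.covBy_iff]
    rfl
  · right
    refine orderIso_of_covBy_iff (e₁.trans OrderDual.toDual) fun a b => ?_
    simp only [Equiv.trans_apply, toDual_covBy_toDual_iff]
    rw [he, h, StdFence.covBy_iff]
    rfl

theorem IsLFence.numMaximalCubes_eq {n : ℕ} {P : Type*} [PartialOrder P] (h : IsLFence n P)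
    (k : ℕ) : numMaximalCubes (filterCube P) k = numMaximalCubes (filterCube (StdFence n)) k :=
  have := h.finite
  numMaximalCubes_filterCube_congr h.orderIso_stdFence k

/-! ### Counting the maximal cube labelings of the standard fence -/

/-- The strict order of the standard fence on indices. -/
def FenceLT (i j : ℕ) : Prop :=
  fenceHeight i < fenceHeight j ∧ (i + 1 = j ∨ j + 1 = i ∨ (i = 2 ∧ j = 0))

/-- The restriction of `F` to the first `n` indices is a maximal cube labeling of the standard
fence. -/
structure IsMaximalFenceLabeling (n : ℕ) (F : ℕ → SignType) : Prop where
  isCubeLabeling : ∀ i < n, ∀ j < n, FenceLT i j → F i = -1 ∨ F j = 1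
  exists_lt : ∀ i < n, F i = 1 → ∃ j < n, FenceLT j i ∧ F j ≠ -1
  exists_gt : ∀ i < n, F i = -1 → ∃ j < n, FenceLT i j ∧ F j ≠ 1

/-- The maximal cube labelings of the standard fence with `k` labels `0`, extended to all
indices by the label `1`. -/
def fenceLabelings (n k : ℕ) : Set (ℕ → SignType) :=
  {F | (∀ i, n ≤ i → F i = 1) ∧ IsMaximalFenceLabeling n F ∧ Nat.count (fun i => F i = 0) n = k}

theorem isMaximalCubeLabeling_stdFence_iff {n : ℕ} (F : ℕ → SignType) :
    IsMaximalCubeLabeling (fun p : StdFence n => F p.idx) ↔ IsMaximalFenceLabeling n F := by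
  constructor
  · rintro ⟨h1, h2, h3⟩
    refine ⟨fun i hi j hj hij => h1 ⟨⟨i, hi⟩⟩ ⟨⟨j, hj⟩⟩ ((StdFence.lt_iff _ _).2 hij), ?_, ?_⟩
    · intro i hi h
      obtain ⟨a, ha, ha'⟩ := h2 ⟨⟨i, hi⟩⟩ h
      exact ⟨a.idx, a.idx.2, (StdFence.lt_iff _ _).1 ha, ha'⟩
    · intro i hi h
      obtain ⟨a, ha, ha'⟩ := h3 ⟨⟨i, hi⟩⟩ h
      exact ⟨a.idx, a.idx.2, (StdFence.lt_iff _ _).1 ha, ha'⟩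
  · rintro ⟨h1, h2, h3⟩
    refine ⟨fun a b hab => h1 _ a.idx.2 _ b.idx.2 ((StdFence.lt_iff _ _).1 hab), ?_, ?_⟩
    · intro p h
      obtain ⟨j, hj, hlt, hj'⟩ := h2 _ p.idx.2 h
      exact ⟨⟨⟨j, hj⟩⟩, (StdFence.lt_iff _ _).2 hlt, hj'⟩
    · intro p h
      obtain ⟨j, hj, hlt, hj'⟩ := h3 _ p.idx.2 h
      exact ⟨⟨⟨j, hj⟩⟩, (StdFence.lt_iff _ _).2 hlt, hj'⟩

theorem ncard_stdFence_zero {n : ℕ} (F : ℕ → SignType) :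
    {p : StdFence n | F p.idx = 0}.ncard = Nat.count (fun i => F i = 0) n := by
  rw [Nat.count_eq_card_filter_range, ← Set.ncard_coe_finset]
  refine Set.ncard_congr (fun p _ => (p.idx : ℕ)) ?_ ?_ ?_
  · intro p hp
    simpa using hp
  · rintro ⟨a⟩ ⟨b⟩ _ _ h
    exact congrArg StdFence.mk (Fin.ext h)
  · intro i hi
    simp only [Finset.coe_filter, Finset.mem_range, Set.mem_ofPred_eq] at hi
    exact ⟨⟨⟨i, hi.1⟩⟩, hi.2, rfl⟩

theorem numMaximalCubes_stdFence (n k : ℕ) :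
    numMaximalCubes (filterCube (StdFence n)) k = (fenceLabelings n k).ncard := by
  rw [numMaximalCubes_eq_ncard]
  symm
  refine Set.ncard_congr (fun F _ p => F p.idx) ?_ ?_ ?_
  · rintro F ⟨-, hF, hk⟩
    exact ⟨(isMaximalCubeLabeling_stdFence_iff F).2 hF, (ncard_stdFence_zero F).trans hk⟩
  · rintro F G ⟨hF, -⟩ ⟨hG, -⟩ h
    funext i
    by_cases hi : i < n
    · exact congrFun h ⟨⟨i, hi⟩⟩
    · rw [hF i (by omega), hG i (by omega)]
  · rintro f ⟨hf, hk⟩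
    let F : ℕ → SignType := fun i => if h : i < n then f ⟨⟨i, h⟩⟩ else 1
    have hF : (fun p : StdFence n => F p.idx) = f := by
      funext p
      simp [F]
    refine ⟨F, ⟨fun i hi => by simp [F, hi.not_gt], ?_, ?_⟩, hF⟩
    · rw [← isMaximalCubeLabeling_stdFence_iff, hF]
      exact hf
    · rw [← hk, ← ncard_stdFence_zero]
      exact congrArg (fun f : StdFence n → SignType => {p | f p = 0}.ncard) hF

theorem finite_tail_eq_one (n : ℕ) : {F : ℕ → SignType | ∀ i, n ≤ i → F i = 1}.Finite := by
  refine Set.Finite.of_finite_image (f := fun F (i : Fin n) => F i) (Set.toFinite _) ?_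
  intro F hF G hG h
  funext i
  by_cases hi : i < n
  · exact congrFun h ⟨i, hi⟩
  · rw [hF i (by omega), hG i (by omega)]

/-- Resetting the prescribed label at `n` to the default `1` is a bijection. Iterating this strips
the forced end of a labeling. -/
theorem ncard_tail_eq_one_last (n : ℕ) (a : SignType) (Q : (ℕ → SignType) → Prop)
    (hQ : ∀ F G : ℕ → SignType, (∀ i < n, F i = G i) → Q F → Q G) :
    {F : ℕ → SignType | (∀ i, n + 1 ≤ i → F i = 1) ∧ F n = a ∧ Q F}.ncard =
      {F : ℕ → SignType | (∀ i, n ≤ i → F i = 1) ∧ Q F}.ncard := by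
  refine Set.ncard_congr (fun F _ => Function.update F n 1) ?_ ?_ ?_
  · rintro F ⟨hF, -, hQF⟩
    refine ⟨fun i hi => ?_, hQ F _ (fun i hi => ?_) hQF⟩
    · by_cases e : i = n
      · rw [e, Function.update_self]
      · rw [Function.update_of_ne e, hF i (by omega)]
    · rw [Function.update_of_ne hi.ne]
  · rintro F G ⟨-, hF, -⟩ ⟨-, hG, -⟩ h
    funext i
    by_cases e : i = n
    · rw [e, hF, hG]
    · simpa [Function.update_of_ne e] using congrFun h i
  · rintro F ⟨hF, hQF⟩
    refine ⟨Function.update F n a, ⟨fun i hi => ?_, Function.update_self .., ?_⟩, ?_⟩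
    · rw [Function.update_of_ne (by omega), hF i (by omega)]
    · exact hQ F _ (fun i hi => by rw [Function.update_of_ne hi.ne]) hQF
    · funext i
      by_cases e : i = n
      · rw [e, Function.update_self, hF n le_rfl]
      · rw [Function.update_of_ne e, Function.update_of_ne e]

theorem IsMaximalFenceLabeling.congr {n : ℕ} {F G : ℕ → SignType} (h : ∀ i < n, F i = G i)
    (hF : IsMaximalFenceLabeling n F) : IsMaximalFenceLabeling n G := by
  refine ⟨fun i hi j hj hij => ?_, fun i hi e => ?_, fun i hi e => ?_⟩
  · rw [← h i hi, ← h j hj]; exact hF.1 i hi j hj hij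
  · obtain ⟨j, hj, h1, h2⟩ := hF.2 i hi (by rw [h i hi, e])
    exact ⟨j, hj, h1, by rwa [← h j hj]⟩
  · obtain ⟨j, hj, h1, h2⟩ := hF.3 i hi (by rw [h i hi, e])
    exact ⟨j, hj, h1, by rwa [← h j hj]⟩

theorem count_zero_congr {n : ℕ} {F G : ℕ → SignType} (h : ∀ i < n, F i = G i) :
    Nat.count (fun i => F i = 0) n = Nat.count (fun i => G i = 0) n := by
  rw [Nat.count_eq_card_filter_range, Nat.count_eq_card_filter_range]
  congr 1
  refine Finset.filter_congr fun i hi => ?_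
  rw [h i (Finset.mem_range.1 hi)]

theorem fenceLT_iff_of_three_le {i j : ℕ} (h : 3 ≤ i ∨ 3 ≤ j) :
    FenceLT i j ↔ i % 2 = 0 ∧ (i + 1 = j ∨ j + 1 = i) := by
  simp only [FenceLT, fenceHeight]
  split_ifs <;> grind

theorem FenceLT.even_left {i j : ℕ} (h : FenceLT i j) (hij : 2 ≤ i ∨ 2 ≤ j) : i % 2 = 0 := by
  revert h
  simp only [FenceLT, fenceHeight]
  split_ifs <;> grind

theorem FenceLT.odd_right {i j : ℕ} (h : FenceLT i j) (hj : 2 ≤ j) : j % 2 = 1 := by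
  revert h
  simp only [FenceLT, fenceHeight]
  split_ifs <;> grind

/-- A maximal cube labeling of the standard fence ends in one of two ways, and the rest of it
is an arbitrary maximal cube labeling of a shorter fence.  Here `s` is the sign of the last
element, which is maximal for `s = 1` and minimal for `s = -1`. -/
theorem isMaximalFenceLabeling_add_three_iff {m : ℕ} (hm : 2 ≤ m) {s : SignType}
    (hs : s = if m % 2 = 1 then 1 else -1) (F : ℕ → SignType) :
    IsMaximalFenceLabeling (m + 3) F ↔
      (F (m + 2) = 0 ∧ F (m + 1) = -s ∧ IsMaximalFenceLabeling (m + 1) F) ∨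
      (F (m + 2) = s ∧ F (m + 1) = 0 ∧ F m = s ∧ IsMaximalFenceLabeling m F) := by
  have hadj : ∀ i j, FenceLT i j → i + 1 = j ∨ j + 1 = i ∨ (i = 2 ∧ j = 0) := fun i j h => h.2
  have heven : ∀ i j, FenceLT i j → 2 ≤ i ∨ 2 ≤ j → i % 2 = 0 := fun i j h => h.even_left
  have hodd : ∀ i j, FenceLT i j → 2 ≤ j → j % 2 = 1 := fun i j h => h.odd_right
  have hcases := fun i => SignType.eq_cases (F i)
  rcases Nat.mod_two_eq_zero_or_one m with hpar | hpar
  · have hs' : s = -1 := by rw [hs, if_neg (by omega)]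
    subst hs'
    have l1 : FenceLT (m + 2) (m + 1) := (fenceLT_iff_of_three_le (by omega)).2 (by omega)
    have l2 : FenceLT m (m + 1) := (fenceLT_iff_of_three_le (by omega)).2 (by omega)
    constructor
    · rintro ⟨h1, h2, h3⟩
      -- For even `m` the elements `m` and `m + 2` are minimal and `m + 1` is maximal, so labels `1`
      -- at `m + 2` and `-1` at `m + 1` would have no witness. A label `-1` at `m + 2` can only be
      -- witnessed by `m + 1`.
      have c1 : F (m + 2) ≠ 1 := by grind
      have c2 : F (m + 1) ≠ -1 := by grind
      have c3 := h1 _ (by omega) _ (by omega) l1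
      rcases hcases (m + 2) with e | e | e
      · right
        have c4 : F (m + 1) = 0 := by grind
        have c5 : F m = -1 := by grind
        refine ⟨e, c4, c5, by grind, by grind, by grind⟩
      · left
        have c4 : F (m + 1) = 1 := by grind
        refine ⟨e, by rw [c4, neg_neg], by grind, by grind, by grind⟩
      · exact absurd e c1
    · rintro (⟨e1, e2, h1, h2, h3⟩ | ⟨e1, e2, e3, h1, h2, h3⟩)
      · rw [neg_neg] at e2
        refine ⟨fun i hi j hj hij => ?_, fun i hi e => ?_, fun i hi e => ?_⟩
        · have a1 := hadj i j hij
          by_cases hj' : j = m + 1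
          · exact Or.inr (hj' ▸ e2)
          · have a2 : i % 2 = 0 ∨ i < 2 := by have := heven i j hij; omega
            have a3 : j % 2 = 1 ∨ j < 2 := by have := hodd i j hij; omega
            exact h1 i (by omega) j (by omega) hij
        · rcases (by omega : i < m + 1 ∨ i = m + 1 ∨ i = m + 2) with h | rfl | rfl
          · obtain ⟨j, hj, h⟩ := h2 i h e
            exact ⟨j, by omega, h⟩
          · exact ⟨m + 2, by omega, l1, by rw [e1]; decide⟩
          · exact absurd (e1.symm.trans e) (by decide)
        · rcases (by omega : i < m + 1 ∨ i = m + 1 ∨ i = m + 2) with h | rfl | rfl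
          · obtain ⟨j, hj, h⟩ := h3 i h e
            exact ⟨j, by omega, h⟩
          · exact absurd (e2.symm.trans e) (by decide)
          · exact absurd (e1.symm.trans e) (by decide)
      · refine ⟨fun i hi j hj hij => ?_, fun i hi e => ?_, fun i hi e => ?_⟩
        · have a1 := hadj i j hij
          by_cases hi' : i = m
          · exact Or.inl (hi' ▸ e3)
          by_cases hi' : i = m + 2
          · exact Or.inl (hi' ▸ e1)
          · have a2 : i % 2 = 0 ∨ i < 2 := by have := heven i j hij; omega
            have a3 : j % 2 = 1 ∨ j < 2 := by have := hodd i j hij; omega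
            exact h1 i (by omega) j (by omega) hij
        · rcases (by omega : i < m ∨ i = m ∨ i = m + 1 ∨ i = m + 2) with h | rfl | rfl | rfl
          · obtain ⟨j, hj, h⟩ := h2 i h e
            exact ⟨j, by omega, h⟩
          · exact absurd (e3.symm.trans e) (by decide)
          · exact absurd (e2.symm.trans e) (by decide)
          · exact absurd (e1.symm.trans e) (by decide)
        · rcases (by omega : i < m ∨ i = m ∨ i = m + 1 ∨ i = m + 2) with h | rfl | rfl | rfl
          · obtain ⟨j, hj, h⟩ := h3 i h e
            exact ⟨j, by omega, h⟩
          · exact ⟨i + 1, by omega, l2, by rw [e2]; decide⟩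
          · exact absurd (e2.symm.trans e) (by decide)
          · exact ⟨m + 1, by omega, l1, by rw [e2]; decide⟩
  -- The dual situation: the last element is maximal.
  · have hs' : s = 1 := by rw [hs, if_pos hpar]
    subst hs'
    have l1 : FenceLT (m + 1) (m + 2) := (fenceLT_iff_of_three_le (by omega)).2 (by omega)
    have l2 : FenceLT (m + 1) m := (fenceLT_iff_of_three_le (by omega)).2 (by omega)
    constructor
    · rintro ⟨h1, h2, h3⟩
      have c1 : F (m + 2) ≠ -1 := by grind
      have c2 : F (m + 1) ≠ 1 := by grind
      have c3 := h1 _ (by omega) _ (by omega) l1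
      rcases hcases (m + 2) with e | e | e
      · exact absurd e c1
      · left
        have c4 : F (m + 1) = -1 := by grind
        refine ⟨e, by grind, by grind, by grind, by grind⟩
      · right
        have c4 : F (m + 1) = 0 := by grind
        have c5 : F m = 1 := by grind
        refine ⟨e, c4, c5, by grind, by grind, by grind⟩
    · rintro (⟨e1, e2, h1, h2, h3⟩ | ⟨e1, e2, e3, h1, h2, h3⟩)
      · refine ⟨fun i hi j hj hij => ?_, fun i hi e => ?_, fun i hi e => ?_⟩
        · have a1 := hadj i j hij
          by_cases hi' : i = m + 1
          · exact Or.inl (hi' ▸ e2)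
          · have a2 : i % 2 = 0 ∨ i < 2 := by have := heven i j hij; omega
            have a3 : j % 2 = 1 ∨ j < 2 := by have := hodd i j hij; omega
            exact h1 i (by omega) j (by omega) hij
        · rcases (by omega : i < m + 1 ∨ i = m + 1 ∨ i = m + 2) with h | rfl | rfl
          · obtain ⟨j, hj, h⟩ := h2 i h e
            exact ⟨j, by omega, h⟩
          · exact absurd (e2.symm.trans e) (by decide)
          · exact absurd (e1.symm.trans e) (by decide)
        · rcases (by omega : i < m + 1 ∨ i = m + 1 ∨ i = m + 2) with h | rfl | rfl
          · obtain ⟨j, hj, h⟩ := h3 i h e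
            exact ⟨j, by omega, h⟩
          · exact ⟨m + 2, by omega, l1, by rw [e1]; decide⟩
          · exact absurd (e1.symm.trans e) (by decide)
      · refine ⟨fun i hi j hj hij => ?_, fun i hi e => ?_, fun i hi e => ?_⟩
        · have a1 := hadj i j hij
          by_cases hj' : j = m
          · exact Or.inr (hj' ▸ e3)
          by_cases hj' : j = m + 2
          · exact Or.inr (hj' ▸ e1)
          · have a2 : i % 2 = 0 ∨ i < 2 := by have := heven i j hij; omega
            have a3 : j % 2 = 1 ∨ j < 2 := by have := hodd i j hij; omega
            exact h1 i (by omega) j (by omega) hij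
        · rcases (by omega : i < m ∨ i = m ∨ i = m + 1 ∨ i = m + 2) with h | rfl | rfl | rfl
          · obtain ⟨j, hj, h⟩ := h2 i h e
            exact ⟨j, by omega, h⟩
          · exact ⟨i + 1, by omega, l2, by rw [e2]; decide⟩
          · exact absurd (e2.symm.trans e) (by decide)
          · exact ⟨m + 1, by omega, l1, by rw [e2]; decide⟩
        · rcases (by omega : i < m ∨ i = m ∨ i = m + 1 ∨ i = m + 2) with h | rfl | rfl | rfl
          · obtain ⟨j, hj, h⟩ := h3 i h e
            exact ⟨j, by omega, h⟩
          · exact absurd (e3.symm.trans e) (by decide)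
          · exact absurd (e2.symm.trans e) (by decide)
          · exact absurd (e1.symm.trans e) (by decide)

/-- The two possible endings are disjoint because they differ at `m + 2`, and each contains exactly
one `0`. -/
theorem fenceLabelings_add_three_ncard {m : ℕ} (hm : 2 ≤ m) (k : ℕ) :
    (fenceLabelings (m + 3) (k + 1)).ncard =
      (fenceLabelings (m + 1) k).ncard + (fenceLabelings m k).ncard := by
  obtain ⟨s, hs⟩ : ∃ s : SignType, s = if m % 2 = 1 then 1 else -1 := ⟨_, rfl⟩
  have hs0 : s ≠ 0 := by rw [hs]; split_ifs <;> decide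
  have hsplit : fenceLabelings (m + 3) (k + 1) =
      {F | (∀ i, m + 3 ≤ i → F i = 1) ∧ F (m + 2) = 0 ∧ F (m + 1) = -s ∧
        IsMaximalFenceLabeling (m + 1) F ∧ Nat.count (fun i => F i = 0) (m + 1) = k} ∪
      {F | (∀ i, m + 3 ≤ i → F i = 1) ∧ F (m + 2) = s ∧ F (m + 1) = 0 ∧ F m = s ∧
        IsMaximalFenceLabeling m F ∧ Nat.count (fun i => F i = 0) m = k} := by
    ext F
    simp only [fenceLabelings, Set.mem_ofPred_eq, Set.mem_union,
      isMaximalFenceLabeling_add_three_iff hm hs]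
    have hc : Nat.count (fun i => F i = 0) (m + 3) = Nat.count (fun i => F i = 0) m +
        (if F m = 0 then 1 else 0) + (if F (m + 1) = 0 then 1 else 0) +
        (if F (m + 2) = 0 then 1 else 0) := by
      rw [Nat.count_succ, Nat.count_succ, Nat.count_succ]
    have hc' : Nat.count (fun i => F i = 0) (m + 1) = Nat.count (fun i => F i = 0) m +
        (if F m = 0 then 1 else 0) := Nat.count_succ _ _
    have hs0' : -s ≠ 0 := by rw [hs]; split_ifs <;> decide
    constructor
    · rintro ⟨h1, ⟨h2, h3, h4⟩ | ⟨h2, h3, h5, h4⟩, hk⟩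
      · refine Or.inl ⟨h1, h2, h3, h4, ?_⟩
        rw [h2, h3, if_neg hs0', if_pos rfl] at hc
        omega
      · refine Or.inr ⟨h1, h2, h3, h5, h4, ?_⟩
        rw [h2, h3, h5, if_neg hs0, if_pos rfl] at hc
        omega
    · rintro (⟨h1, h2, h3, h4, hk⟩ | ⟨h1, h2, h3, h5, h4, hk⟩)
      · refine ⟨h1, Or.inl ⟨h2, h3, h4⟩, ?_⟩
        rw [h2, h3, if_neg hs0', if_pos rfl] at hc
        omega
      · refine ⟨h1, Or.inr ⟨h2, h3, h5, h4⟩, ?_⟩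
        rw [h2, h3, h5, if_neg hs0, if_pos rfl] at hc
        omega
  have hfin := finite_tail_eq_one (m + 3)
  rw [hsplit, Set.ncard_union_eq _ (hfin.subset fun F hF => hF.1) (hfin.subset fun F hF => hF.1)]
  · congr 1
    · rw [ncard_tail_eq_one_last, ncard_tail_eq_one_last]
      · rfl
      · rintro F G h ⟨h1, h2⟩
        exact ⟨h1.congr h, by rwa [← count_zero_congr h]⟩
      · rintro F G h ⟨h0, h1, h2⟩
        have h' : ∀ i < m + 1, F i = G i := fun i hi => h i (by omega)
        exact ⟨by rwa [← h _ (by omega)], h1.congr h', by rwa [← count_zero_congr h']⟩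
    · rw [ncard_tail_eq_one_last, ncard_tail_eq_one_last, ncard_tail_eq_one_last]
      · rfl
      · rintro F G h ⟨h1, h2⟩
        exact ⟨h1.congr h, by rwa [← count_zero_congr h]⟩
      · rintro F G h ⟨h0, h1, h2⟩
        have h' : ∀ i < m, F i = G i := fun i hi => h i (by omega)
        exact ⟨by rwa [← h _ (by omega)], h1.congr h', by rwa [← count_zero_congr h']⟩
      · rintro F G h ⟨h0, h3, h1, h2⟩
        have h' : ∀ i < m, F i = G i := fun i hi => h i (by omega)
        exact ⟨by rwa [← h _ (by omega)], by rwa [← h _ (by omega)], h1.congr h',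
          by rwa [← count_zero_congr h']⟩
  · rw [Set.disjoint_left]
    rintro F ⟨-, h1, -⟩ ⟨-, h2, -⟩
    exact hs0 (h2.symm.trans h1)

/-! ### Short fences -/

instance : DecidableRel FenceLT := fun i j => by
  unfold FenceLT
  infer_instance

/-- The maximal cube labelings of the standard fence, as words. -/
def fenceWords (n : ℕ) : Finset (Fin n → SignType) :=
  Finset.univ.filter fun f =>
    (∀ i j : Fin n, FenceLT i j → f i = -1 ∨ f j = 1) ∧
    (∀ i, f i = 1 → ∃ j : Fin n, FenceLT j i ∧ f j ≠ -1) ∧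
    (∀ i, f i = -1 → ∃ j : Fin n, FenceLT i j ∧ f j ≠ 1)

theorem mem_fenceWords_iff {n : ℕ} (F : ℕ → SignType) :
    (fun i : Fin n => F i) ∈ fenceWords n ↔ IsMaximalFenceLabeling n F := by
  simp only [fenceWords, Finset.mem_filter, Finset.mem_univ, true_and, Fin.forall_iff,
    Fin.exists_iff]
  constructor
  · rintro ⟨h1, h2, h3⟩
    exact ⟨fun i hi j hj => h1 i hi j hj,
      fun i hi e => let ⟨j, hj, h⟩ := h2 i hi e; ⟨j, hj, h⟩,
      fun i hi e => let ⟨j, hj, h⟩ := h3 i hi e; ⟨j, hj, h⟩⟩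
  · rintro ⟨h1, h2, h3⟩
    exact ⟨fun i hi j hj => h1 i hi j hj,
      fun i hi e => let ⟨j, hj, h⟩ := h2 i hi e; ⟨j, hj, h⟩,
      fun i hi e => let ⟨j, hj, h⟩ := h3 i hi e; ⟨j, hj, h⟩⟩

/-- The multiset of zero counts handles all `k` at once and can be evaluated by `decide` for short
fences. -/
theorem ncard_fenceLabelings_eq_count (n k : ℕ) :
    (fenceLabelings n k).ncard =
      ((fenceWords n).val.map fun f => (Finset.univ.filter fun i => f i = 0).card).count k := by
  rw [Multiset.count_map]
  change _ = ((fenceWords n).filter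
    fun f => k = (Finset.univ.filter fun i => f i = 0).card).card
  rw [← Set.ncard_coe_finset]
  have hcount : ∀ F : ℕ → SignType, (Finset.univ.filter fun i : Fin n => F i = 0).card =
      Nat.count (fun i => F i = 0) n := fun F => by
    rw [Nat.count_eq_card_filter_range, Finset.card_filter, Finset.card_filter,
      Fin.sum_univ_eq_sum_range fun i => if F i = 0 then 1 else 0]
  refine Set.ncard_congr (fun F _ i => F i) ?_ ?_ ?_
  · rintro F ⟨-, hF, hk⟩
    simp only [Finset.coe_filter, Set.mem_ofPred_eq]
    exact ⟨(mem_fenceWords_iff F).2 hF, by rw [hcount, hk]⟩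
  · rintro F G ⟨hF, -⟩ ⟨hG, -⟩ h
    funext i
    by_cases hi : i < n
    · exact congrFun h ⟨i, hi⟩
    · rw [hF i (by omega), hG i (by omega)]
  · intro f hf
    simp only [Finset.coe_filter, Set.mem_ofPred_eq] at hf
    let F : ℕ → SignType := fun i => if h : i < n then f ⟨i, h⟩ else 1
    have hF : (fun i : Fin n => F i) = f := by
      funext i
      simp [F]
    refine ⟨F, ⟨fun i hi => by simp [F, hi.not_gt], ?_, ?_⟩, hF⟩
    · rw [← mem_fenceWords_iff, hF]
      exact hf.1
    · rw [hf.2, ← hcount, ← hF]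

theorem ncard_fenceLabelings_zero (k : ℕ) :
    (fenceLabelings 0 k).ncard = if k = 0 then 1 else 0 := by
  rw [ncard_fenceLabelings_eq_count, show Multiset.map _ _ = {0} by decide]
  simp [Multiset.count_singleton]

theorem ncard_fenceLabelings_one (k : ℕ) :
    (fenceLabelings 1 k).ncard = if k = 1 then 1 else 0 := by
  rw [ncard_fenceLabelings_eq_count, show Multiset.map _ _ = {1} by decide]
  simp [Multiset.count_singleton]

theorem ncard_fenceLabelings_two (k : ℕ) :
    (fenceLabelings 2 k).ncard = if k = 1 then 2 else 0 := by
  rw [ncard_fenceLabelings_eq_count, show Multiset.map _ _ = Multiset.replicate 2 1 by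
    decide, Multiset.count_replicate]
  simp [eq_comm]

theorem ncard_fenceLabelings_three (k : ℕ) :
    (fenceLabelings 3 k).ncard = if k = 1 then 3 else 0 := by
  rw [ncard_fenceLabelings_eq_count, show Multiset.map _ _ = Multiset.replicate 3 1 by
    decide, Multiset.count_replicate]
  simp [eq_comm]

theorem ncard_fenceLabelings_four (k : ℕ) :
    (fenceLabelings 4 k).ncard = (if k = 2 then 2 else 0) + if k = 1 then 1 else 0 := by
  rw [ncard_fenceLabelings_eq_count, show Multiset.map _ _ = Multiset.replicate 2 2 + {1} by
    decide, Multiset.count_add, Multiset.count_replicate, Multiset.count_singleton]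
  simp [eq_comm]

/-! ### Generating functions -/

theorem ncard_fenceLabelings_of_lt {n k : ℕ} (h : n < k) : (fenceLabelings n k).ncard = 0 := by
  have : fenceLabelings n k = ∅ := by
    rw [Set.eq_empty_iff_forall_notMem]
    rintro F ⟨-, -, hk⟩
    have := Nat.count_le (p := fun i => F i = 0) (n := n)
    omega
  rw [this, Set.ncard_empty]

theorem ncard_fenceLabelings_add_three_zero {m : ℕ} (hm : 2 ≤ m) :
    (fenceLabelings (m + 3) 0).ncard = 0 := by
  have : fenceLabelings (m + 3) 0 = ∅ := by
    rw [Set.eq_empty_iff_forall_notMem]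
    rintro F ⟨-, hF, hk⟩
    rw [isMaximalFenceLabeling_add_three_iff hm rfl] at hF
    rw [Nat.count_succ, Nat.count_succ] at hk
    rcases hF with h | h
    · simp [h.1] at hk
    · simp [h.2.1] at hk
  rw [this, Set.ncard_empty]

theorem IsLFence.numMaximalCubes_eq_ncard {n : ℕ} {P : Type*} [PartialOrder P] (h : IsLFence n P)
    (k : ℕ) : numMaximalCubes (filterCube P) k = (fenceLabelings n k).ncard := by
  rw [h.numMaximalCubes_eq, numMaximalCubes_stdFence]

theorem IsLFence.coeff_maximalCubePoly {n : ℕ} {P : Type*} [PartialOrder P] (h : IsLFence n P)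
    (k : ℕ) : (maximalCubePoly (filterCube P)).coeff k = ((fenceLabelings n k).ncard : ℤ) := by
  -- A `finsum` with infinite support would be `0` by default. Here the support is finite since `n`
  -- elements carry at most `n` zeros.
  have hsupp : (Function.support fun k : ℕ =>
      Polynomial.C (numMaximalCubes (filterCube P) k : ℤ) * Polynomial.X ^ k) ⊆
      (Finset.range (n + 1) : Finset ℕ) := by
    intro j hj
    by_contra hjn
    rw [Finset.coe_range, Set.mem_Iio] at hjn
    apply hj
    simp [h.numMaximalCubes_eq_ncard, ncard_fenceLabelings_of_lt (show n < j by omega)]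
  rw [maximalCubePoly, finsum_eq_sum_of_support_subset _ hsupp, Polynomial.finsetSum_coeff]
  simp only [Polynomial.coeff_C_mul_X_pow, Finset.sum_ite_eq, Finset.mem_range,
    h.numMaximalCubes_eq_ncard]
  split_ifs with hk
  · rfl
  · rw [ncard_fenceLabelings_of_lt (show n < k by omega)]
    rfl

/-- The generating function of a sequence with a Padovan recurrence. -/
theorem mk_eq_of_padovan_recurrence {R : Type*} [CommRing R] (r : R) (a : ℕ → R)
    (ha : ∀ n, a (n + 3) = r * (a (n + 1) + a n)) :
    PowerSeries.mk a = (PowerSeries.C (a 0) + PowerSeries.C (a 1) * PowerSeries.X +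
      PowerSeries.C (a 2 - r * a 0) * PowerSeries.X ^ 2) *
      PowerSeries.invOfUnit
        (1 - PowerSeries.C r * PowerSeries.X ^ 2 * (1 + PowerSeries.X)) 1 := by
  have hunit := PowerSeries.mul_invOfUnit
    (1 - PowerSeries.C r * PowerSeries.X ^ 2 * (1 + PowerSeries.X)) 1 (by simp)
  have key : PowerSeries.mk a * (1 - PowerSeries.C r * PowerSeries.X ^ 2 * (1 + PowerSeries.X)) =
      PowerSeries.C (a 0) + PowerSeries.C (a 1) * PowerSeries.X +
      PowerSeries.C (a 2 - r * a 0) * PowerSeries.X ^ 2 := by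
    have hexp : PowerSeries.mk a *
        (1 - PowerSeries.C r * PowerSeries.X ^ 2 * (1 + PowerSeries.X)) =
        PowerSeries.mk a - PowerSeries.C r * (PowerSeries.mk a * PowerSeries.X ^ 2) -
          PowerSeries.C r * (PowerSeries.mk a * PowerSeries.X ^ 3) := by ring
    -- The recurrence cancels all coefficients from degree `3` on, and in degree `2` the denominator
    -- contributes `-r * a 0`.
    rw [hexp]
    ext n
    simp only [map_sub, map_add, PowerSeries.coeff_C_mul, PowerSeries.coeff_mul_X_pow',
      PowerSeries.coeff_mk, PowerSeries.coeff_C, PowerSeries.coeff_X]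
    match n with
    | 0 => simp
    | 1 => simp
    | 2 => simp
    | n + 3 =>
      simp [ha, show n + 3 - 2 = n + 1 by omega]
      ring
  rw [← key, mul_assoc, hunit, mul_one]

theorem mainTheorem8 (Ξ : ℕ → Type*) [∀ n, PartialOrder (Ξ n)]
    (hΞ : ∀ n, IsLFence n (Ξ n)) :
    -- the recurrence for `h_{n,k}` (with `h_{n,-1} = 0`)
    (∀ n : ℕ, 5 ≤ n →
      numMaximalCubes (filterCube (Ξ n)) 0 = 0 ∧
      ∀ k : ℕ, numMaximalCubes (filterCube (Ξ n)) (k + 1) =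
        numMaximalCubes (filterCube (Ξ (n - 2))) k +
          numMaximalCubes (filterCube (Ξ (n - 3))) k) ∧
    -- the generating function of `H_n(x)`, in `ℤ[x]⟦y⟧`
    (PowerSeries.mk (fun n => maximalCubePoly (filterCube (Ξ n))) =
      (2 + PowerSeries.X) *
          PowerSeries.invOfUnit
            (1 - PowerSeries.C Polynomial.X * PowerSeries.X ^ 2 * (1 + PowerSeries.X)) 1
        - (1 - PowerSeries.C Polynomial.X) * PowerSeries.X - 1) ∧
    -- the generating function of the `(1,2,3)`-Padovan numbers, in `ℤ⟦y⟧`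
    (PowerSeries.mk (fun n => (padovan123 n : ℤ)) =
      (1 + 2 * PowerSeries.X + 2 * PowerSeries.X ^ 2) *
        PowerSeries.invOfUnit (1 - PowerSeries.X ^ 2 - PowerSeries.X ^ 3) 1) := by
  refine ⟨fun n hn => ?_, ?_, ?_⟩
  · obtain ⟨m, rfl⟩ : ∃ m, n = m + 3 := ⟨n - 3, by omega⟩
    simp only [(hΞ _).numMaximalCubes_eq_ncard]
    exact ⟨ncard_fenceLabelings_add_three_zero (by omega),
      fun k => fenceLabelings_add_three_ncard (by omega) k⟩
  · set H : ℕ → Polynomial ℤ := fun n => maximalCubePoly (filterCube (Ξ n)) with hH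
    have hcoeff : ∀ n k, (H n).coeff k = ((fenceLabelings n k).ncard : ℤ) :=
      fun n k => (hΞ n).coeff_maximalCubePoly k
    have h0 : H 0 = 1 := by
      ext k
      rw [hcoeff, ncard_fenceLabelings_zero, Polynomial.coeff_one]
      split_ifs <;> simp
    have h1 : H 1 = Polynomial.X := by
      ext k
      rw [hcoeff, ncard_fenceLabelings_one, Polynomial.coeff_X]
      simp [eq_comm]
    have h2 : H 2 = 2 * Polynomial.X := by
      ext k
      rw [hcoeff, ncard_fenceLabelings_two, Polynomial.coeff_ofNat_mul, Polynomial.coeff_X]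
      simp [eq_comm]
    have h3 : H 3 = 3 * Polynomial.X := by
      ext k
      rw [hcoeff, ncard_fenceLabelings_three, Polynomial.coeff_ofNat_mul, Polynomial.coeff_X]
      simp [eq_comm]
    have h4 : H 4 = 2 * Polynomial.X ^ 2 + Polynomial.X := by
      ext k
      rw [hcoeff, ncard_fenceLabelings_four, Polynomial.coeff_add, Polynomial.coeff_ofNat_mul,
        Polynomial.coeff_X, Polynomial.coeff_X_pow]
      simp [eq_comm]
    have hrec : ∀ n, 2 ≤ n → H (n + 3) = Polynomial.X * (H (n + 1) + H n) := by
      intro n hn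
      ext k
      cases k with
      | zero => simp [hcoeff, ncard_fenceLabelings_add_three_zero hn]
      | succ k =>
        rw [hcoeff, Polynomial.coeff_X_mul, Polynomial.coeff_add, hcoeff, hcoeff,
          fenceLabelings_add_three_ncard hn, Nat.cast_add]
    -- The recurrence for `H` starts only at `n = 5`. Extending it backwards through `H 4` and `H 3`
    -- requires the values `1` and `2` at `n = 1` and `n = 0`. The corrections `1 - x` and `1` are
    -- the terms subtracted in the generating function.
    let a : ℕ → Polynomial ℤ := fun n =>
      H n + if n = 0 then 1 else if n = 1 then 1 - Polynomial.X else 0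
    have ha : ∀ n, a (n + 3) = Polynomial.X * (a (n + 1) + a n) := by
      intro n
      match n with
      | 0 => simp [a, h0, h1, h3]; ring
      | 1 => simp [a, h2, h1, h4]; ring
      | n + 2 => simpa [a] using hrec (n + 2) (by omega)
    have hmk : PowerSeries.mk H = PowerSeries.mk a -
        (1 - PowerSeries.C Polynomial.X) * PowerSeries.X - 1 := by
      have e : (1 - PowerSeries.C Polynomial.X : PowerSeries (Polynomial ℤ)) =
          PowerSeries.C (1 - Polynomial.X) := by simp
      rw [e]
      ext1 n
      simp only [map_sub, PowerSeries.coeff_mk, PowerSeries.coeff_one, a]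
      match n with
      | 0 => simp
      | 1 => simp
      | n + 2 => simp
    rw [hmk, mk_eq_of_padovan_recurrence _ _ ha]
    have a0 : a 0 = 2 := by simp [a, h0]; norm_num
    have a1 : a 1 = 1 := by simp [a, h1]
    have a2 : a 2 = 2 * Polynomial.X := by simp [a, h2]
    rw [a0, a1, a2, show (2 * Polynomial.X - Polynomial.X * 2 : Polynomial ℤ) = 0 by ring,
      show PowerSeries.C (2 : Polynomial ℤ) = 2 from map_ofNat _ 2]
    simp
  · have e : (1 - PowerSeries.C 1 * PowerSeries.X ^ 2 * (1 + PowerSeries.X) : PowerSeries ℤ) =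
        1 - PowerSeries.X ^ 2 - PowerSeries.X ^ 3 := by
      rw [map_one]
      ring
    have e2 : (PowerSeries.C 2 : PowerSeries ℤ) = 2 := map_ofNat _ 2
    rw [mk_eq_of_padovan_recurrence 1 _ fun n => by simp [padovan123], e]
    simp only [padovan123]
    norm_num [e2]
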